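/- For $n,d\ge 1$ let $F_{n,d}$ be the real vector space of forms (homogeneous polynomials) of degree $d$ in $\mathbb R[x_1,\dots,x_n]$, together with $0$, let $F^k_{n,d}\subset F_{n,d}$ be the set of those with at most $k$ terms (at most $k$ monomials with non-zero coefficient), and let $$\Sigma^k_{n,2d}=\Bigl\{\sum_{j=1}^m h_j^2 \;:\; m\in\mathbb N,\ h_j\in F^k_{n,d}\Bigr\}.$$ Put $N(n,d)=\binom{n+d-1}{n-1}$ and let $2\le k\le N(n,d)$. Then: (a) $\Sigma^{k-1}_{n,2d}\subsetneq\Sigma^k_{n,2d}$. (b) If $h\in F_{n,d}$ has exactly $k$ terms and is either indefinite (it takes both positive and negative values on $\mathbb R^n$) and irreducible in $\mathbb R[x_1,\dots,x_n]$, or a product of real linear forms, then $h^2\in\Sigma^k_{n,2d}\setminus\Sigma^{k-1}_{n,2d}$. (c) Forms as in (b) exist: if $n=2$, there is a product of real linear forms in $F_{2,d}$ with exactly $k$ terms; if $n\ge 3$, there is an indefinite irreducible form in $F_{n,d}$ with exactly $k$ terms. -/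

import Mathlib

namespace SosTerms

noncomputable section

/-- The number of monomials of degree `d` in `n ≥ 1` variables. -/
def N (n d : ℕ) : ℕ := Nat.choose (n + d - 1) (n - 1)

/-- The real vector space of forms of degree `d` in `n` variables (including the zero form). -/
def F (n d : ℕ) : Submodule ℝ (MvPolynomial (Fin n) ℝ) :=
  MvPolynomial.homogeneousSubmodule (Fin n) ℝ d

/-- The forms of degree `d` in `n` variables with at most `k` terms. -/
def FTerms (n d k : ℕ) : Set (MvPolynomial (Fin n) ℝ) :=
  {p | p ∈ F n d ∧ p.support.card ≤ k}

/-- The cone of finite sums of squares of forms of degree `d` in `n` variables, each with at most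
`k` terms; its elements are forms of degree `2 * d`. -/
def Sigma (n d k : ℕ) : Set (MvPolynomial (Fin n) ℝ) :=
  {f | ∃ (m : ℕ) (h : Fin m → MvPolynomial (Fin n) ℝ),
    (∀ j, h j ∈ FTerms n d k) ∧ f = ∑ j, h j ^ 2}

/-- A real polynomial is indefinite if it takes both positive and negative values. -/
def Indefinite {n : ℕ} (h : MvPolynomial (Fin n) ℝ) : Prop :=
  (∃ x : Fin n → ℝ, 0 < MvPolynomial.eval x h) ∧ ∃ y : Fin n → ℝ, MvPolynomial.eval y h < 0

/-- A finite product of real linear forms. -/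
def IsProductOfLinearForms {n : ℕ} (h : MvPolynomial (Fin n) ℝ) : Prop :=
  ∃ (m : ℕ) (l : Fin m → MvPolynomial (Fin n) ℝ), (∀ i, l i ∈ F n 1) ∧ h = ∏ i, l i

end

end SosTerms

namespace SosTerms

/-! If `h ^ 2` is a sum of squares of forms `g j`, every `g j` vanishes at the real zeros of `h`.
When `h` is indefinite and irreducible, this forces `h ∣ g j` (`dvd_of_forall_eval_eq_zero`); for a
product of linear forms the factors are split off one at a time. Equal degrees make `g j` a scalar
multiple of `h`, hence zero or with exactly `k` terms, so `k - 1` terms never suffice. This is (b),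
and (a) follows once (c) supplies such an `h`.

For `n = 2` take `X 0 ^ (d + 1 - k) * (X 0 + X 1) ^ (k - 1)`. For `n ≥ 3` give two monomials with
irreducible sum coefficient `1` and `k - 2` others coefficient `±2`. Modulo the maximal ideal of a
valuation ring of `ℝ` containing `2` only the irreducible binomial remains, and irreducibility lifts
(`irreducible_map_of_irreducible_residue`); the free signs secure indefiniteness. -/

open MvPolynomial

/-! ### Divisibility by an indefinite irreducible polynomial -/

/-- The substitution `X i ↦ X i + v i * T`, where `T` is a new variable. -/
noncomputable def lineSubst {n : ℕ} (v : Fin n → ℝ) :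
    MvPolynomial (Fin n) ℝ →ₐ[ℝ] Polynomial (MvPolynomial (Fin n) ℝ) :=
  aeval fun i => Polynomial.C (X i) + Polynomial.C (C (v i)) * Polynomial.X

/-- The endomorphism of `ℝ[X][T]` that fixes `T` and extends `lineSubst v`. -/
noncomputable def lineShear {n : ℕ} (v : Fin n → ℝ) :
    Polynomial (MvPolynomial (Fin n) ℝ) →+* Polynomial (MvPolynomial (Fin n) ℝ) :=
  Polynomial.eval₂RingHom (lineSubst v : MvPolynomial (Fin n) ℝ →+* _) Polynomial.X

lemma lineShear_C {n : ℕ} (v : Fin n → ℝ) (p : MvPolynomial (Fin n) ℝ) :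
    lineShear v (Polynomial.C p) = lineSubst v p := by
  simp [lineShear]

lemma lineShear_comp {n : ℕ} (v w : Fin n → ℝ) (hvw : ∀ i, w i = -v i) :
    (lineShear v).comp (lineShear w) = RingHom.id _ := by
  refine Polynomial.ringHom_ext' (MvPolynomial.ringHom_ext ?_ ?_) ?_
  · intro r
    simp [lineShear_C, lineSubst, IsScalarTower.algebraMap_apply ℝ (MvPolynomial (Fin n) ℝ)
      (Polynomial (MvPolynomial (Fin n) ℝ))]
  · intro i
    simp [lineShear_C, lineSubst, hvw]
    simp [lineShear, lineSubst]
    ring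
  · simp [lineShear]

lemma eval₂_lineSubst {n : ℕ} (v u : Fin n → ℝ) (s : ℝ) (p : MvPolynomial (Fin n) ℝ) :
    Polynomial.eval₂ (eval u) s (lineSubst v p) = eval (fun i => u i + s * v i) p := by
  induction p using MvPolynomial.induction_on with
  | C a => simp [lineSubst, IsScalarTower.algebraMap_apply ℝ (MvPolynomial (Fin n) ℝ)
      (Polynomial (MvPolynomial (Fin n) ℝ))]
  | add p q hp hq => simp [hp, hq, Polynomial.eval₂_add]
  | mul_X p i hp =>
    rw [map_mul, Polynomial.eval₂_mul, hp]
    simp only [lineSubst, aeval_X, Polynomial.eval₂_add, Polynomial.eval₂_mul, Polynomial.eval₂_C,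
      eval_X, eval_C, Polynomial.eval₂_X, map_mul]
    ring

lemma eval_zero_lineSubst {n : ℕ} (v : Fin n → ℝ) (p : MvPolynomial (Fin n) ℝ) :
    Polynomial.eval 0 (lineSubst v p) = p := by
  induction p using MvPolynomial.induction_on with
  | C a => simp [lineSubst, IsScalarTower.algebraMap_apply ℝ (MvPolynomial (Fin n) ℝ)
      (Polynomial (MvPolynomial (Fin n) ℝ))]
  | add p q hp hq => simp [hp, hq]
  | mul_X p i hp =>
    rw [map_mul, Polynomial.eval_mul, hp]
    simp [lineSubst]

/-- The shears by `v` and `-v` are mutually inverse, and `lineSubst v h` is the image of the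
constant `C h`. -/
lemma irreducible_lineSubst {n : ℕ} (v : Fin n → ℝ) {h : MvPolynomial (Fin n) ℝ}
    (hirr : Irreducible h) : Irreducible (lineSubst v h) := by
  let e : Polynomial (MvPolynomial (Fin n) ℝ) ≃+* Polynomial (MvPolynomial (Fin n) ℝ) :=
    RingEquiv.ofRingHom (lineShear v) (lineShear fun i => -v i)
      (lineShear_comp _ _ fun _ => rfl) (lineShear_comp _ _ fun i => by simp)
  have h1 : Irreducible (Polynomial.C h) := (Polynomial.prime_C_iff.2 hirr.prime).irreducible
  have h2 : e (Polynomial.C h) = lineSubst v h := lineShear_C v h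
  rw [← h2]
  exact (MulEquiv.irreducible_iff e).2 h1

/-- Over a unique factorization domain, a polynomial that is irreducible and of positive degree
generates, together with any non-multiple, an ideal that contains a non-zero constant. -/
lemma exists_bezout_C {A : Type*} [CommRing A] [IsDomain A] [UniqueFactorizationMonoid A]
    {H P : Polynomial A} (hH : Irreducible H) (hdeg : H.natDegree ≠ 0) (hP : ¬ H ∣ P) :
    ∃ (a b : Polynomial A) (r : A), r ≠ 0 ∧ a * H + b * P = Polynomial.C r := by
  classical
  let K := FractionRing A
  -- Gauss's lemma passes to the principal ideal domain `K[T]`; clearing denominators in a Bézout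
  -- identity there gives the claim.
  have hprim : H.IsPrimitive := hH.isPrimitive hdeg
  have hK : Irreducible (H.map (algebraMap A K)) :=
    hprim.irreducible_iff_irreducible_map_fraction_map.1 hH
  have hd : ¬ H.map (algebraMap A K) ∣ P.map (algebraMap A K) := fun h =>
    hP (hprim.dvd_of_fraction_map_dvd_fraction_map h)
  obtain ⟨a, b, hab⟩ := (hK.coprime_iff_not_dvd).2 hd
  obtain ⟨c, c0, hc⟩ := IsLocalization.integerNormalization_spec (nonZeroDivisors A) a
  obtain ⟨e, e0, he⟩ := IsLocalization.integerNormalization_spec (nonZeroDivisors A) b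
  refine ⟨Polynomial.C e * IsLocalization.integerNormalization (nonZeroDivisors A) a,
    Polynomial.C c * IsLocalization.integerNormalization (nonZeroDivisors A) b, c * e,
    mul_ne_zero (nonZeroDivisors.ne_zero c0) (nonZeroDivisors.ne_zero e0), ?_⟩
  apply Polynomial.map_injective (algebraMap A K) (IsFractionRing.injective A K)
  simp only [Polynomial.map_add, Polynomial.map_mul, Polynomial.map_C, hc, he, map_mul,
    Algebra.smul_def]
  linear_combination Polynomial.C (algebraMap A K c) * Polynomial.C (algebraMap A K e) * hab

/-- A polynomial that vanishes at all real zeros of an indefinite irreducible polynomial is a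
multiple of it. -/
theorem dvd_of_forall_eval_eq_zero {n : ℕ} {h p : MvPolynomial (Fin n) ℝ} (hirr : Irreducible h)
    (hind : Indefinite h) (hz : ∀ x, eval x h = 0 → eval x p = 0) : h ∣ p := by
  obtain ⟨⟨x, hx⟩, y, hy⟩ := hind
  by_contra hdvd
  set v : Fin n → ℝ := fun i => y i - x i with hv
  have hdvd' : ¬ lineSubst v h ∣ lineSubst v p := by
    rintro ⟨q, hq⟩
    refine hdvd ⟨Polynomial.eval 0 q, ?_⟩
    rw [← eval_zero_lineSubst v p, hq, Polynomial.eval_mul, eval_zero_lineSubst]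
  have hdeg : (lineSubst v h).natDegree ≠ 0 := by
    intro h0
    have h1 := eval₂_lineSubst v x 0 h
    have h2 := eval₂_lineSubst v x 1 h
    rw [Polynomial.eq_C_of_natDegree_eq_zero h0, Polynomial.eval₂_C] at h1 h2
    rw [h1] at h2
    simp only [hv, zero_mul, add_zero, one_mul, add_sub_cancel] at h2
    change eval x h = eval y h at h2
    linarith
  obtain ⟨a, b, r, hr, hab⟩ := exists_bezout_C (irreducible_lineSubst v hirr) hdeg hdvd'
  -- The segment from `u` to `u + v` contains a zero of `h`, hence of `p`, and the Bézout identity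
  -- evaluates there to `r(u) = 0`. Such `u` fill a neighbourhood of `x`, so `r = 0`.
  have hroot : ∀ u, 0 < eval u h → eval (fun i => u i + v i) h < 0 → eval u r = 0 := by
    intro u hu1 hu2
    have hcont : Continuous fun s : ℝ => eval (fun i => u i + s * v i) h :=
      (MvPolynomial.continuous_eval h).comp (by fun_prop)
    obtain ⟨s, -, hs⟩ := intermediate_value_Icc' (zero_le_one' ℝ) hcont.continuousOn
      (show (0 : ℝ) ∈ Set.Icc _ _ by constructor <;> simp [hu1.le, hu2.le])
    have key := congrArg (Polynomial.eval₂ (eval u) s) hab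
    simp only [Polynomial.eval₂_add, Polynomial.eval₂_mul, eval₂_lineSubst, Polynomial.eval₂_C]
      at key
    simp only at hs
    rw [← key, hz _ hs, hs, mul_zero, mul_zero, add_zero]
  have hopen : IsOpen {u : Fin n → ℝ | 0 < eval u h ∧ eval (fun i => u i + v i) h < 0} :=
    (isOpen_lt continuous_const (MvPolynomial.continuous_eval h)).inter
      (isOpen_lt ((MvPolynomial.continuous_eval h).comp (by fun_prop)) continuous_const)
  obtain ⟨ε, hε, hball⟩ := Metric.isOpen_iff.1 hopen x ⟨hx, by simpa [hv] using hy⟩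
  refine hr (MvPolynomial.funext_set (fun i => Metric.ball (x i) ε) (fun i => ?_) fun u hu => ?_)
  · rw [Real.ball_eq_Ioo]
    exact Set.Ioo_infinite (by linarith)
  · rw [← ball_pi x hε] at hu
    obtain ⟨h1, h2⟩ := hball hu
    simpa using hroot u h1 h2

/-! ### Sums of squares equal to `h ^ 2` -/

lemma eval_neg_linear {n : ℕ} {l : MvPolynomial (Fin n) ℝ} (hl : l ∈ F n 1) (x : Fin n → ℝ) :
    eval (fun i => -x i) l = -eval x l := by
  replace hl : l ∈ Submodule.span ℝ (Set.range (X : Fin n → MvPolynomial (Fin n) ℝ)) :=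
    homogeneousSubmodule_one_eq_span_X (σ := Fin n) (R := ℝ) ▸ hl
  induction hl using Submodule.span_induction with
  | mem p hp => obtain ⟨i, rfl⟩ := hp; simp
  | zero => simp
  | add p q _ _ hp hq => rw [map_add, map_add, hp, hq, neg_add]
  | smul a p _ hp => rw [smul_eval, smul_eval, hp, mul_neg]

lemma indefinite_of_linear {n : ℕ} {l : MvPolynomial (Fin n) ℝ} (hl : l ∈ F n 1) (h0 : l ≠ 0) :
    Indefinite l := by
  obtain ⟨x, hx⟩ : ∃ x, eval x l ≠ 0 := by
    by_contra! hall
    exact h0 (MvPolynomial.funext fun x => by simpa using hall x)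
  have hneg := eval_neg_linear hl x
  rcases lt_or_gt_of_ne hx with h | h
  · exact ⟨⟨fun i => -x i, by linarith⟩, x, h⟩
  · exact ⟨⟨x, h⟩, fun i => -x i, by linarith⟩

lemma irreducible_of_linear {n : ℕ} {l : MvPolynomial (Fin n) ℝ} (hl : l ∈ F n 1) (h0 : l ≠ 0) :
    Irreducible l := by
  refine irreducible_of_totalDegree_eq_one (IsHomogeneous.totalDegree hl h0) fun x hx => ?_
  obtain ⟨m, hm⟩ := MvPolynomial.ne_zero_iff.1 h0
  exact isUnit_iff_ne_zero.2 fun hx0 => hm (by simpa [hx0] using hx m)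

/-- An indefinite irreducible divisor of `h` divides every summand of a representation of `h ^ 2` as
a sum of squares. -/
lemma dvd_of_sq_eq_sum_sq {n m : ℕ} {l h : MvPolynomial (Fin n) ℝ} (hirr : Irreducible l)
    (hind : Indefinite l) (hlh : l ∣ h) {g : Fin m → MvPolynomial (Fin n) ℝ}
    (hg : h ^ 2 = ∑ j, g j ^ 2) (j : Fin m) : l ∣ g j := by
  refine dvd_of_forall_eval_eq_zero hirr hind fun x hx => ?_
  obtain ⟨q, rfl⟩ := hlh
  have h1 := congrArg (eval x) hg
  simp only [map_pow, map_mul, hx, zero_mul, map_sum] at h1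
  rw [eq_comm, zero_pow two_ne_zero, Finset.sum_eq_zero_iff_of_nonneg fun _ _ => sq_nonneg _] at h1
  exact pow_eq_zero_iff two_ne_zero |>.1 (h1 j (Finset.mem_univ j))

lemma prod_linear_dvd_of_sq_eq_sum_sq {n : ℕ} : ∀ (m : ℕ) (l : Fin m → MvPolynomial (Fin n) ℝ),
    (∀ i, l i ∈ F n 1) → ∏ i, l i ≠ 0 → ∀ {q : ℕ} (g : Fin q → MvPolynomial (Fin n) ℝ),
      (∏ i, l i) ^ 2 = ∑ j, g j ^ 2 → ∀ j, ∏ i, l i ∣ g j := by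
  intro m
  induction m with
  | zero => intro l _ _ q g _ j; simp
  | succ m ih =>
    intro l hl h0 q g hg j
    rw [Fin.prod_univ_succ] at h0 hg ⊢
    have hl0 := left_ne_zero_of_mul h0
    have hdvd := dvd_of_sq_eq_sum_sq (irreducible_of_linear (hl 0) hl0)
      (indefinite_of_linear (hl 0) hl0) (dvd_mul_right _ _) hg
    -- Cancelling `l 0 ^ 2` leaves an identity of the same shape for the remaining factors.
    choose g' hg' using hdvd
    rw [hg' j]
    refine mul_dvd_mul_left _ (ih _ (fun i => hl i.succ) (right_ne_zero_of_mul h0) g' ?_ j)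
    apply mul_left_cancel₀ (pow_ne_zero 2 hl0)
    rw [← mul_pow, hg, Finset.mul_sum]
    exact Finset.sum_congr rfl fun j _ => by rw [hg' j, mul_pow]

/-- A non-zero form that is a multiple of a form of the same degree has the same terms. -/
lemma support_eq_of_dvd {n d : ℕ} {h g : MvPolynomial (Fin n) ℝ} (hh : h ∈ F n d) (hg : g ∈ F n d)
    (hg0 : g ≠ 0) (hdvd : h ∣ g) : g.support = h.support := by
  obtain ⟨q, rfl⟩ := hdvd
  have hh0 := left_ne_zero_of_mul hg0
  have hq0 := right_ne_zero_of_mul hg0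
  have h1 := totalDegree_mul_of_isDomain hh0 hq0
  rw [IsHomogeneous.totalDegree hg hg0, IsHomogeneous.totalDegree hh hh0] at h1
  have hq : q = C (coeff 0 q) := totalDegree_eq_zero_iff_eq_C.1 (by omega)
  have hc : coeff 0 q ≠ 0 := fun h => hq0 (by rw [hq, h, C_0])
  ext m
  rw [hq]
  simp [mul_comm h, hc]

lemma sq_notMem_sigma {n d k : ℕ} (hk : 2 ≤ k) {h : MvPolynomial (Fin n) ℝ} (hh : h ∈ F n d)
    (hcard : h.support.card = k)
    (hdvd : ∀ (m : ℕ) (g : Fin m → MvPolynomial (Fin n) ℝ), h ^ 2 = ∑ j, g j ^ 2 → ∀ j, h ∣ g j) :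
    h ^ 2 ∉ Sigma n d (k - 1) := by
  rintro ⟨m, g, hg, hsum⟩
  have hzero : ∀ j, g j = 0 := by
    intro j
    by_contra h0
    have h1 := support_eq_of_dvd hh (hg j).1 h0 (hdvd m g hsum j)
    have h2 := (hg j).2
    rw [h1] at h2
    omega
  simp only [hzero, zero_pow two_ne_zero, Finset.sum_const_zero] at hsum
  rw [pow_eq_zero_iff two_ne_zero] at hsum
  rw [hsum, support_zero, Finset.card_empty] at hcard
  omega

theorem sq_mem_sigma_diff {n d k : ℕ} (hk : 2 ≤ k) {h : MvPolynomial (Fin n) ℝ} (hh : h ∈ F n d)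
    (hcard : h.support.card = k)
    (hcase : (Indefinite h ∧ Irreducible h) ∨ IsProductOfLinearForms h) :
    h ^ 2 ∈ Sigma n d k \ Sigma n d (k - 1) := by
  refine ⟨⟨1, fun _ => h, fun _ => ⟨hh, hcard.le⟩, by simp⟩, sq_notMem_sigma hk hh hcard ?_⟩
  intro m g hg
  rcases hcase with ⟨hind, hirr⟩ | ⟨q, l, hl, rfl⟩
  · exact dvd_of_sq_eq_sum_sq hirr hind dvd_rfl hg
  · refine prod_linear_dvd_of_sq_eq_sum_sq q l hl (fun h0 => ?_) g hg
    rw [h0, support_zero, Finset.card_empty] at hcard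
    omega

lemma sigma_mono {n d k k' : ℕ} (hkk : k ≤ k') : Sigma n d k ⊆ Sigma n d k' := by
  rintro _ ⟨m, g, hg, rfl⟩
  exact ⟨m, g, fun j => ⟨(hg j).1, (hg j).2.trans hkk⟩, rfl⟩

/-! ### Lifting irreducibility from the residue field of a valuation ring -/

/-- A non-zero polynomial over the fraction field of a valuation ring is a scalar multiple of a
polynomial over the valuation ring with non-zero reduction. -/
lemma exists_primitive_multiple {σ K : Type*} [Field K] (V : ValuationSubring K)
    {p : MvPolynomial σ K} (hp : p ≠ 0) :
    ∃ (a : K) (p' : MvPolynomial σ V), a ≠ 0 ∧ p = C a * map (algebraMap V K) p' ∧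
      map (IsLocalRing.residue V) p' ≠ 0 := by
  classical
  -- Dividing by a coefficient of largest valuation makes all coefficients integral and turns this
  -- one into `1`, which survives reduction.
  obtain ⟨m, hm, hmax⟩ := p.support.exists_max_image (fun m => V.valuation (coeff m p))
    (support_nonempty.2 hp)
  have ha : coeff m p ≠ 0 := mem_support_iff.1 hm
  have hV : ∀ i, coeff i p / coeff m p ∈ V := by
    intro i
    rw [← V.valuation_le_one_iff, map_div₀]
    by_cases hi : i ∈ p.support
    · exact div_le_one_of_le₀ (hmax i hi) zero_le
    · simp [notMem_support_iff.1 hi]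
  have hmem : C (coeff m p)⁻¹ * p ∈ (map (algebraMap V K) : MvPolynomial σ V →+* _).range := by
    rw [RingHom.mem_range]
    refine ⟨∑ i ∈ p.support, monomial i ⟨_, hV i⟩, ?_⟩
    ext i
    by_cases hi : coeff i p = 0
    · simp [coeff_sum, coeff_monomial, hi]
    · simp [coeff_sum, coeff_monomial, hi, div_eq_inv_mul]
  obtain ⟨p', hp'⟩ := hmem
  refine ⟨coeff m p, p', ha, ?_, fun h0 => ?_⟩
  · rw [hp', ← mul_assoc, ← C_mul, mul_inv_cancel₀ ha, C_1, one_mul]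
  · have h1 := congrArg (coeff m) hp'
    rw [coeff_map, coeff_C_mul, inv_mul_cancel₀ ha] at h1
    have h2 : coeff m p' = 1 := IsFractionRing.injective V K (by rw [h1, map_one])
    have h3 := congrArg (coeff m) h0
    rw [coeff_map, h2, map_one, coeff_zero] at h3
    exact one_ne_zero h3

lemma isUnit_iff_totalDegree_eq_zero {σ K : Type*} [Field K] {q : MvPolynomial σ K} (hq : q ≠ 0) :
    IsUnit q ↔ q.totalDegree = 0 := by
  rw [isUnit_iff_totalDegree_of_isReduced, and_iff_right_iff_imp]
  intro h
  rw [isUnit_iff_ne_zero]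
  intro h0
  rw [totalDegree_eq_zero_iff_eq_C, h0, C_0] at h
  exact hq h

/-- A polynomial over a valuation ring is irreducible over the fraction field if its reduction is
irreducible of the same degree. -/
theorem irreducible_map_of_irreducible_residue {σ K : Type*} [Field K] (V : ValuationSubring K)
    {f : MvPolynomial σ V} (hf : Irreducible (map (IsLocalRing.residue V) f))
    (hdeg : (map (IsLocalRing.residue V) f).totalDegree = f.totalDegree) :
    Irreducible (map (algebraMap V K) f) := by
  have hinj : Function.Injective (map (algebraMap V K) : MvPolynomial σ V → _) :=
    map_injective _ (IsFractionRing.injective V K)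
  have hf0 : f ≠ 0 := by rintro rfl; simp at hf
  have hdegK : ∀ q : MvPolynomial σ V, (map (algebraMap V K) q).totalDegree = q.totalDegree :=
    fun q => by
      rw [totalDegree, totalDegree, support_map_of_injective q (IsFractionRing.injective V K)]
  have hne : ∀ q : MvPolynomial σ V, q ≠ 0 → map (algebraMap V K) q ≠ 0 := fun q hq h =>
    hq (hinj (by rw [h, map_zero]))
  refine ⟨fun hu => hf.not_isUnit ?_, fun p q hpq => ?_⟩
  · rw [isUnit_iff_totalDegree_eq_zero (hne f hf0), hdegK] at hu
    rw [isUnit_iff_totalDegree_eq_zero hf.ne_zero, hdeg, hu]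
  have hpq0 : p * q ≠ 0 := hpq ▸ hne f hf0
  have hp0 := left_ne_zero_of_mul hpq0
  have hq0 := right_ne_zero_of_mul hpq0
  obtain ⟨a, p', ha, hp, hp'⟩ := exists_primitive_multiple V hp0
  obtain ⟨b, q', hb, hq, hq'⟩ := exists_primitive_multiple V hq0
  have hf' : map (algebraMap V K) f = C (a * b) * map (algebraMap V K) (p' * q') := by
    rw [hpq, hp, hq, C_mul, map_mul]; ring
  -- Otherwise `(a * b)⁻¹` reduces to `0`, and so would `p' * q'`, a product with non-zero
  -- reductions.
  have hab : a * b ∈ V := by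
    by_contra hab
    have hinv : (a * b)⁻¹ ∈ V := (V.mem_or_inv_mem _).resolve_left hab
    have h1 : C ⟨_, hinv⟩ * f = p' * q' := by
      apply hinj
      rw [map_mul, hf', map_C, ← mul_assoc, ← C_mul]
      change C ((a * b)⁻¹ * (a * b)) * _ = _
      rw [inv_mul_cancel₀ (mul_ne_zero ha hb), C_1, one_mul]
    have h2 := congrArg (map (IsLocalRing.residue V)) h1
    have h3 : IsLocalRing.residue V ⟨_, hinv⟩ = 0 := by
      rw [IsLocalRing.residue_eq_zero_iff, ← ValuationSubring.coe_mem_nonunits_iff]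
      exact V.inv_mem_nonunits_iff.2 (.inr hab)
    rw [map_mul, map_C, h3, C_0, zero_mul, map_mul] at h2
    exact mul_ne_zero hp' hq' h2.symm
  have hfV : f = C ⟨a * b, hab⟩ * (p' * q') := by
    apply hinj
    rw [hf', map_mul _ (C _), map_C]
    rfl
  have hfR : map (IsLocalRing.residue V) f = C (IsLocalRing.residue V ⟨a * b, hab⟩) *
      map (IsLocalRing.residue V) p' * map (IsLocalRing.residue V) q' := by
    conv_lhs => rw [hfV]
    simp only [map_mul, map_C, mul_assoc]
  set c := IsLocalRing.residue V ⟨a * b, hab⟩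
  have hc : c ≠ 0 := by
    intro hc
    rw [hc, C_0, zero_mul, zero_mul] at hfR
    exact hf.ne_zero hfR
  have hcu : IsUnit (C c : MvPolynomial σ (IsLocalRing.ResidueField V)) :=
    (isUnit_iff_ne_zero.2 hc).map C
  have hdegR : (map (IsLocalRing.residue V) p').totalDegree +
      (map (IsLocalRing.residue V) q').totalDegree = f.totalDegree := by
    rw [← hdeg, hfR, totalDegree_mul_of_isDomain (mul_ne_zero (by simpa using hc) hp') hq',
      totalDegree_mul_of_isDomain (by simpa using hc) hp', totalDegree_C, zero_add]
  have hdegpq : p.totalDegree + q.totalDegree = f.totalDegree := by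
    rw [← totalDegree_mul_of_isDomain hp0 hq0, ← hpq, hdegK]
  have hp'0 : p' ≠ 0 := by rintro rfl; simp at hp'
  have hq'0 : q' ≠ 0 := by rintro rfl; simp at hq'
  have hdp : p.totalDegree = p'.totalDegree := by
    rw [hp, totalDegree_mul_of_isDomain (by simpa using ha) (hne p' hp'0), totalDegree_C, zero_add,
      hdegK]
  have hdq : q.totalDegree = q'.totalDegree := by
    rw [hq, totalDegree_mul_of_isDomain (by simpa using hb) (hne q' hq'0), totalDegree_C, zero_add,
      hdegK]
  -- Reduction cannot raise degrees, and both degree sums equal `f.totalDegree`; so each factor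
  -- keeps its degree, and a factor with unit reduction is constant.
  have hlep : (map (IsLocalRing.residue V) p').totalDegree ≤ p'.totalDegree :=
    Finset.sup_mono (support_map_subset _ _)
  have hleq : (map (IsLocalRing.residue V) q').totalDegree ≤ q'.totalDegree :=
    Finset.sup_mono (support_map_subset _ _)
  rcases hf.isUnit_or_isUnit hfR with hu | hu
  · left
    rw [isUnit_iff_totalDegree_eq_zero hp0]
    have := (isUnit_iff_totalDegree_eq_zero hp').1 (isUnit_of_mul_isUnit_right hu)
    omega
  · right
    rw [isUnit_iff_totalDegree_eq_zero hq0]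
    have := (isUnit_iff_totalDegree_eq_zero hq').1 hu
    omega

/-- There is a valuation subring of the reals whose maximal ideal contains `2`. -/
lemma exists_valuationSubring_two : ∃ V : ValuationSubring ℝ, (2 : ℝ) ∈ V.nonunits := by
  obtain ⟨V, -, hV⟩ := Ideal.image_subset_nonunits_valuationSubring (K := ℝ)
    (A := (Int.castRingHom ℝ).range) (Ideal.span {2}) (by
      rw [Ne, Ideal.span_singleton_eq_top]
      intro hu
      obtain ⟨⟨_, z, rfl⟩, hz⟩ := hu.exists_right_inv
      have h1 : (2 : ℝ) * (z : ℝ) = 1 := congrArg Subtype.val hz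
      have h2 : 2 * z = 1 := by exact_mod_cast h1
      omega)
  exact ⟨V, hV ⟨2, Ideal.mem_span_singleton_self _, rfl⟩⟩

/-! ### Indefinite irreducible forms for `n ≥ 3` -/

section SumMonomial

variable {σ R : Type*} [CommSemiring R]

open scoped Classical in
lemma coeff_sum_monomial (S : Finset (σ →₀ ℕ)) (c : (σ →₀ ℕ) → R) (i : σ →₀ ℕ) :
    coeff i (∑ m ∈ S, monomial m (c m)) = if i ∈ S then c i else 0 := by
  simp [coeff_sum, coeff_monomial]

lemma support_sum_monomial (S : Finset (σ →₀ ℕ)) {c : (σ →₀ ℕ) → R} (hc : ∀ m ∈ S, c m ≠ 0) :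
    (∑ m ∈ S, monomial m (c m)).support = S := by
  classical
  ext i
  rw [mem_support_iff, coeff_sum_monomial]
  by_cases hi : i ∈ S <;> simp [hi, hc]

end SumMonomial

/-- `X i₀ ^ a * X i₁ + X i₂ ^ b` is irreducible over every field. -/
lemma irreducible_add_monomial {σ K : Type*} [Field K] {i₀ i₁ i₂ : σ} (h01 : i₀ ≠ i₁)
    (h02 : i₀ ≠ i₂) (h12 : i₁ ≠ i₂) (a b : ℕ) :
    Irreducible (monomial (Finsupp.single i₀ a + Finsupp.single i₁ 1) 1 +
      monomial (Finsupp.single i₂ b) 1 : MvPolynomial σ K) := by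
  classical
  set p : MvPolynomial σ K := monomial (Finsupp.single i₀ a + Finsupp.single i₁ 1) 1 +
    monomial (Finsupp.single i₂ b) 1 with hp
  have hne : Finsupp.single i₀ a + Finsupp.single i₁ 1 ≠ Finsupp.single i₂ b := fun h => by
    have := DFunLike.congr_fun h i₁
    simp [h01.symm, h12] at this
  have hsupp : p.support = {Finsupp.single i₀ a + Finsupp.single i₁ 1, Finsupp.single i₂ b} := by
    rw [hp, ← Finset.sum_pair (f := fun m => monomial m (1 : K)) hne]
    exact support_sum_monomial _ fun _ _ => one_ne_zero
  have hdisj : Disjoint (Finsupp.single i₀ a + Finsupp.single i₁ 1).support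
      (Finsupp.single i₂ b).support := by
    rw [Finset.disjoint_left]
    intro i hi hi'
    have h2 := Finset.mem_singleton.1 (Finsupp.support_single_subset hi')
    subst h2
    simp [h02, h12] at hi
  -- The two exponents have disjoint supports and `X i₁` occurs with exponent exactly `1`.
  refine irreducible_of_disjoint_support (i := i₁)
    (d := Finsupp.single i₀ a + Finsupp.single i₁ 1) ?_ (by simp [hsupp])
    (by simp [h01]) ?_ ?_
  · rw [hsupp]
    exact ⟨_, by simp, _, by simp, hne⟩
  · rw [hsupp, Finset.coe_insert, Finset.coe_singleton]
    intro x hx y hy hxy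
    rcases hx with rfl | rfl <;> rcases hy with rfl | rfl
    · exact absurd rfl hxy
    · exact hdisj
    · exact hdisj.symm
    · exact absurd rfl hxy
  · intro r hr
    refine isUnit_iff_ne_zero.2 fun h0 => ?_
    have h1 := hr (Finsupp.single i₂ b)
    rw [h0, zero_dvd_iff] at h1
    exact mem_support_iff.1 (show Finsupp.single i₂ b ∈ p.support by simp [hsupp]) h1

lemma card_finsuppAntidiag_univ {n : ℕ} (hn : 1 ≤ n) (d : ℕ) :
    ((Finset.univ : Finset (Fin n)).finsuppAntidiag d).card = N n d := by
  rw [Finset.card_finsuppAntidiag_nat_eq_choose, Finset.card_univ, Fintype.card_fin, N]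
  exact Nat.choose_symm_of_eq_add (by omega)

lemma exists_indefinite_irreducible {n d k : ℕ} (hn : 3 ≤ n) (hd : 1 ≤ d) (hk : 2 ≤ k)
    (hkN : k ≤ N n d) :
    ∃ h ∈ F n d, h.support.card = k ∧ Indefinite h ∧ Irreducible h := by
  classical
  obtain ⟨V, hV⟩ := exists_valuationSubring_two
  have hres : IsLocalRing.residue V 2 = 0 := by
    rw [IsLocalRing.residue_eq_zero_iff, ← ValuationSubring.coe_mem_nonunits_iff]
    exact hV
  let i₀ : Fin n := ⟨0, by omega⟩
  let i₁ : Fin n := ⟨1, by omega⟩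
  let i₂ : Fin n := ⟨2, by omega⟩
  have h01 : i₀ ≠ i₁ := by simp [i₀, i₁]
  have h02 : i₀ ≠ i₂ := by simp [i₀, i₂]
  have h12 : i₁ ≠ i₂ := by simp [i₁, i₂]
  let m₁ : Fin n →₀ ℕ := Finsupp.single i₀ (d - 1) + Finsupp.single i₁ 1
  let m₂ : Fin n →₀ ℕ := Finsupp.single i₂ d
  have hne : m₁ ≠ m₂ := fun h => by
    have := DFunLike.congr_fun h i₁
    simp [m₁, m₂, h01, h12.symm] at this
  have hdeg₁ : m₁.degree = d := by
    simp only [m₁, map_add, Finsupp.degree_single]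
    omega
  have hdeg₂ : m₂.degree = d := by simp [m₂]
  have hmem : ∀ m : Fin n →₀ ℕ, m ∈ (Finset.univ : Finset (Fin n)).finsuppAntidiag d ↔
      m.degree = d := by
    intro m
    simp [Finset.mem_finsuppAntidiag, Finsupp.degree_eq_sum]
  obtain ⟨S, hS, hSd, hScard⟩ := Finset.exists_subsuperset_card_eq (s := {m₁, m₂})
    (t := (Finset.univ : Finset (Fin n)).finsuppAntidiag d) (n := k)
    (by
      intro m hm
      rcases Finset.mem_insert.1 hm with rfl | hm
      · exact (hmem _).2 hdeg₁
      · rw [Finset.mem_singleton.1 hm]; exact (hmem _).2 hdeg₂)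
    (by rw [Finset.card_pair hne]; exact hk)
    (by rw [card_finsuppAntidiag_univ (by omega)]; exact hkN)
  have hSdeg : ∀ m ∈ S, m.degree = d := fun m hm => (hmem m).1 (hSd hm)
  have hm₁S : m₁ ∈ S := hS (by simp)
  have hm₂S : m₂ ∈ S := hS (by simp)
  -- At `y` the monomial `m₁` is `-1` and `m₂` is `0`; the signs in `c` make every other term
  -- non-positive.
  let y : Fin n → ℝ := fun i => if i = i₀ then 1 else if i = i₁ then -1 else 0
  let c : (Fin n →₀ ℕ) → V := fun m =>
    if m ∈ ({m₁, m₂} : Finset _) then 1 else if 0 ≤ ∏ i, y i ^ m i then -2 else 2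
  have hc0 : ∀ m, c m ≠ 0 := by
    intro m
    have h2 : (2 : V) ≠ 0 := fun h => two_ne_zero (α := ℝ) (congrArg Subtype.val h)
    simp only [c]
    split_ifs
    · exact one_ne_zero
    · exact neg_ne_zero.2 h2
    · exact h2
  let f : MvPolynomial (Fin n) V := ∑ m ∈ S, monomial m (c m)
  have hfhom : f.IsHomogeneous d :=
    IsHomogeneous.sum _ _ _ fun m hm => isHomogeneous_monomial _ (hSdeg m hm)
  have hf0 : f ≠ 0 := by
    rw [← support_nonempty, support_sum_monomial S fun m _ => hc0 m]
    exact ⟨m₁, hm₁S⟩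
  have hfres : map (IsLocalRing.residue V) f = monomial m₁ 1 + monomial m₂ 1 := by
    rw [← Finset.sum_pair (f := fun m => monomial m (1 : IsLocalRing.ResidueField V)) hne]
    ext i
    rw [coeff_map, coeff_sum_monomial, coeff_sum_monomial _ fun _ => 1]
    by_cases hi : i ∈ ({m₁, m₂} : Finset _)
    · simp only [if_pos hi, if_pos (hS hi), c, map_one]
    · simp only [if_neg hi, c]
      split_ifs <;> simp [hres]
  have hirr : Irreducible (map (IsLocalRing.residue V) f) :=
    hfres ▸ irreducible_add_monomial h01 h02 h12 _ _
  have heval : ∀ x, eval x (map (algebraMap V ℝ) f) =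
      ∑ m ∈ S, algebraMap V ℝ (c m) * ∏ i, x i ^ m i := by
    intro x
    simp only [f, map_sum, map_monomial, eval_monomial]
    refine Finset.sum_congr rfl fun m _ => ?_
    rw [Finsupp.prod_fintype _ _ fun i => pow_zero _]
  have hcm₁ : c m₁ = 1 := by simp [c]
  have hcm₂ : c m₂ = 1 := by simp [c]
  -- At `Pi.single i₂ 1` every degree-`d` monomial except `m₂` vanishes, so the value is `1`.
  refine ⟨map (algebraMap V ℝ) f, hfhom.map _, ?_, ⟨⟨Pi.single i₂ 1, ?_⟩, y, ?_⟩,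
    irreducible_map_of_irreducible_residue V hirr ?_⟩
  · rw [support_map_of_injective _ (IsFractionRing.injective V ℝ),
      support_sum_monomial S fun m _ => hc0 m, hScard]
  · rw [heval, Finset.sum_eq_single m₂]
    · rw [hcm₂, map_one, one_mul]
      refine Finset.prod_pos fun i _ => ?_
      by_cases hi : i = i₂
      · simp [hi]
      · simp [m₂, Ne.symm hi]
    · intro m hm hmne
      obtain ⟨i, hi, hmi⟩ : ∃ i, i ≠ i₂ ∧ m i ≠ 0 := by
        by_contra! hall
        have hm' : m = Finsupp.single i₂ (m i₂) := by
          ext i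
          by_cases hi : i = i₂
          · simp [hi]
          · simp [hall i hi, Ne.symm hi]
        have h1 := hSdeg m hm
        rw [hm', Finsupp.degree_single] at h1
        exact hmne (by rw [hm', h1])
      rw [Finset.prod_eq_zero (Finset.mem_univ i), mul_zero]
      simp [hi, hmi]
    · exact fun h => absurd hm₂S h
  · have hprod₁ : ∏ i, y i ^ m₁ i = -1 := by
      rw [Finset.prod_eq_single i₁]
      · simp [y, m₁, h01.symm]
      · intro i _ hi
        by_cases hi0 : i = i₀
        · simp [y, hi0]
        · simp [m₁, Ne.symm hi, Ne.symm hi0]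
      · simp
    have hprod₂ : ∏ i, y i ^ m₂ i = 0 := by
      apply Finset.prod_eq_zero (Finset.mem_univ i₂)
      simp [y, m₂, h02.symm, h12.symm]
      omega
    rw [heval]
    refine Finset.sum_neg' (fun m _ => ?_) ⟨m₁, hm₁S, by rw [hcm₁, hprod₁]; simp⟩
    by_cases hm : m ∈ ({m₁, m₂} : Finset _)
    · rcases Finset.mem_insert.1 hm with rfl | hm
      · rw [hcm₁, hprod₁]; simp
      · rw [Finset.mem_singleton.1 hm, hprod₂, mul_zero]
    · by_cases hpos : 0 ≤ ∏ i, y i ^ m i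
      · simp only [c, if_neg hm, if_pos hpos, map_neg, map_ofNat]
        linarith
      · simp only [c, if_neg hm, if_neg hpos, map_ofNat]
        linarith
  · rw [(hfhom.map _).totalDegree hirr.ne_zero, hfhom.totalDegree hf0]

/-! ### Products of linear forms for `n = 2` -/

lemma isProductOfLinearForms_mul_pow {n : ℕ} {p l : MvPolynomial (Fin n) ℝ}
    (hp : IsProductOfLinearForms p) (hl : l ∈ F n 1) (e : ℕ) :
    IsProductOfLinearForms (p * l ^ e) := by
  obtain ⟨m, g, hg, rfl⟩ := hp
  refine ⟨m + e, Fin.append g fun _ => l, fun i => ?_, ?_⟩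
  · refine Fin.addCases (fun i => ?_) (fun i => ?_) i
    · simpa using hg i
    · simpa using hl
  · simp [Fin.prod_univ_add]

lemma exists_product_linear {d k : ℕ} (hk : 2 ≤ k) (hkd : k ≤ d + 1) :
    ∃ h ∈ F 2 d, h.support.card = k ∧ IsProductOfLinearForms h := by
  have hX : ∀ i : Fin 2, (X i : MvPolynomial (Fin 2) ℝ).IsHomogeneous 1 := isHomogeneous_X ℝ
  let e : ℕ → Fin 2 →₀ ℕ := fun j => Finsupp.single 0 (d - j) + Finsupp.single 1 j
  have he : Function.Injective e := fun i j hij => by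
    simpa [e] using DFunLike.congr_fun hij 1
  -- The leading `1` is the empty product to which the powers of linear forms are appended.
  have hexp : (1 * X 0 ^ (d + 1 - k) * (X 0 + X 1) ^ (k - 1) : MvPolynomial (Fin 2) ℝ) =
      ∑ m ∈ (Finset.range k).map ⟨e, he⟩, monomial m (((k - 1).choose (m 1) : ℕ) : ℝ) := by
    rw [Finset.sum_map, add_comm (X 0), add_pow, Finset.mul_sum, Nat.sub_add_cancel (by omega)]
    refine Finset.sum_congr rfl fun j hj => ?_
    have hjk := Finset.mem_range.1 hj
    have h1 : d - j = (d + 1 - k) + (k - 1 - j) := by omega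
    simp only [e, Function.Embedding.coeFn_mk, h1]
    rw [monomial_eq, Finsupp.prod_fintype _ _ fun i => pow_zero _]
    simp [Fin.prod_univ_two, pow_add]
    ring
  refine ⟨1 * X 0 ^ (d + 1 - k) * (X 0 + X 1) ^ (k - 1), ?_, ?_, ?_⟩
  · have h1 := (((isHomogeneous_one (Fin 2) ℝ).mul ((hX 0).pow (d + 1 - k))).mul
      (((hX 0).add (hX 1)).pow (k - 1)))
    have h2 : 0 + 1 * (d + 1 - k) + 1 * (k - 1) = d := by omega
    rw [h2] at h1
    exact h1
  · rw [hexp, support_sum_monomial, Finset.card_map, Finset.card_range]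
    intro m hm
    obtain ⟨j, hj, rfl⟩ := Finset.mem_map.1 hm
    have hjk := Finset.mem_range.1 hj
    simpa [e] using (Nat.choose_pos (show j ≤ k - 1 by omega)).ne'
  · exact isProductOfLinearForms_mul_pow (isProductOfLinearForms_mul_pow
      ⟨0, Fin.elim0, fun i => i.elim0, by simp⟩ (hX 0) _) ((hX 0).add (hX 1)) _

end SosTerms

theorem theorem1p2 (n d k : ℕ) (hk : 2 ≤ k) (hkN : k ≤ SosTerms.N n d) :
    SosTerms.Sigma n d (k - 1) ⊂ SosTerms.Sigma n d k ∧
    (∀ h ∈ SosTerms.F n d, h.support.card = k →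
      ((SosTerms.Indefinite h ∧ Irreducible h) ∨ SosTerms.IsProductOfLinearForms h) →
      h ^ 2 ∈ SosTerms.Sigma n d k \ SosTerms.Sigma n d (k - 1)) ∧
    (∃ h ∈ SosTerms.F n d, h.support.card = k ∧
      ((n = 2 ∧ SosTerms.IsProductOfLinearForms h) ∨
        (3 ≤ n ∧ SosTerms.Indefinite h ∧ Irreducible h))) := by
  -- If `d = 0` or `n ≤ 1`, then `N n d ≤ 1 < k`; truncated subtraction covers `n = 0`.
  have hd : 1 ≤ d := by
    rcases Nat.eq_zero_or_pos d with rfl | h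
    · simp [SosTerms.N] at hkN; omega
    · exact h
  have hn : 2 ≤ n := by
    by_contra! h
    have h0 : n - 1 = 0 := by omega
    simp [SosTerms.N, h0] at hkN; omega
  have hex : ∃ h ∈ SosTerms.F n d, h.support.card = k ∧
      ((n = 2 ∧ SosTerms.IsProductOfLinearForms h) ∨
        (3 ≤ n ∧ SosTerms.Indefinite h ∧ Irreducible h)) := by
    rcases hn.eq_or_lt with rfl | hn
    · have hkd : k ≤ d + 1 := by
        have h1 : 2 + d - 1 = d + 1 := by omega
        simpa [SosTerms.N, h1] using hkN
      obtain ⟨h, hF, hcard, hl⟩ := SosTerms.exists_product_linear hk hkd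
      exact ⟨h, hF, hcard, .inl ⟨rfl, hl⟩⟩
    · obtain ⟨h, hF, hcard, hi⟩ := SosTerms.exists_indefinite_irreducible hn hd hk hkN
      exact ⟨h, hF, hcard, .inr ⟨hn, hi⟩⟩
  have hb : ∀ h ∈ SosTerms.F n d, h.support.card = k →
      ((SosTerms.Indefinite h ∧ Irreducible h) ∨ SosTerms.IsProductOfLinearForms h) →
      h ^ 2 ∈ SosTerms.Sigma n d k \ SosTerms.Sigma n d (k - 1) := fun h hF hcard hcase =>
    SosTerms.sq_mem_sigma_diff hk hF hcard hcase
  refine ⟨?_, hb, hex⟩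
  obtain ⟨h, hF, hcard, hcase⟩ := hex
  have hmem := hb h hF hcard (hcase.elim (fun h => .inr h.2) fun h => .inl h.2)
  exact ⟨SosTerms.sigma_mono (Nat.sub_le k 1), fun hsub => hmem.2 (hsub hmem.1)⟩
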